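/- For all integers $\alpha,\beta$ with $\alpha\neq 1$ and $\beta\neq 1$, the Macdonald group $$G(\alpha,\beta)=\langle A,B\mid A^{[A,B]}=A^{\alpha},\ B^{[B,A]}=B^{\beta}\rangle,$$ where $[x,y]=x^{-1}y^{-1}xy$ and $x^{y}=y^{-1}xy$, is nilpotent. Moreover, $G(\alpha,\beta)$ is finite and it is the internal direct product of its Sylow subgroups: whenever $P_p$ is a Sylow $p$-subgroup of $G(\alpha,\beta)$ for each prime divisor $p$ of $|G(\alpha,\beta)|$, the subgroups $P_p$ are normal, each intersects trivially the subgroup generated by the others, and together they generate $G(\alpha,\beta)$. -/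

import Mathlib

namespace MacdonaldGroup

/-- The commutator convention `[x, y] = x⁻¹ y⁻¹ x y` (Mathlib's `⁅x, y⁆` is `x y x⁻¹ y⁻¹`). -/
def commut {T : Type*} [Group T] (x y : T) : T := x⁻¹ * y⁻¹ * x * y

/-- The conjugation convention `x ^ y = y⁻¹ x y`. -/
def conjBy {T : Type*} [Group T] (x y : T) : T := y⁻¹ * x * y

/-- The relators of the Macdonald group: with `A = of 0` and `B = of 1` in the free group on two
generators, they express `A ^ [A, B] = A ^ α` and `B ^ [B, A] = B ^ β`. -/
def relators (α β : ℤ) : Set (FreeGroup (Fin 2)) :=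
  let A : FreeGroup (Fin 2) := FreeGroup.of 0
  let B : FreeGroup (Fin 2) := FreeGroup.of 1
  {conjBy A (commut A B) * (A ^ α)⁻¹, conjBy B (commut B A) * (B ^ β)⁻¹}

end MacdonaldGroup

/-- The Macdonald group `G(α, β) = ⟨A, B | A ^ [A, B] = A ^ α, B ^ [B, A] = B ^ β⟩`. -/
abbrev MacdonaldGroup (α β : ℤ) : Type := PresentedGroup (MacdonaldGroup.relators α β)

/-- `G` is the (internal) direct product of the family `H` of subgroups: every `H i` is normal,
every `H i` meets the subgroup generated by the other members trivially, and together
they generate `G`. -/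
def IsInternalDirectProduct {G : Type*} [Group G] {ι : Type*} (H : ι → Subgroup G) : Prop :=
  (∀ i, (H i).Normal) ∧ (∀ i, H i ⊓ (⨆ (j : ι) (_ : j ≠ i), H j) = ⊥) ∧ (⨆ i, H i) = ⊤

open Finset in
theorem geom_sum_range_mul (a : ℤ) (k m : ℕ) :
    ∑ i ∈ range (k * m), a ^ i = (∑ i ∈ range k, a ^ i) * ∑ i ∈ range m, (a ^ k) ^ i := by
  induction m with
  | zero => simp
  | succ m ih =>
    rw [Nat.mul_succ, sum_range_add, ih, sum_range_succ _ m, mul_add, ← pow_mul]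
    simp only [pow_add, ← mul_sum]
    ring

open Finset in
theorem dvd_geom_sum_sub_card {d a : ℤ} (h : d ∣ a - 1) (n : ℕ) :
    d ∣ ∑ i ∈ range n, a ^ i - n := by
  have h1 : (∑ i ∈ range n, a ^ i - n : ℤ) = ∑ i ∈ range n, (a ^ i - 1) := by simp
  rw [h1]
  exact dvd_sum fun i _ => h.trans (sub_one_dvd_pow_sub_one a i)

open Finset in
theorem prime_dvd_geom_sum {a : ℤ} {p : ℕ} (h : (p : ℤ) ∣ a - 1) :
    (p : ℤ) ∣ ∑ i ∈ range p, a ^ i := by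
  simpa using dvd_add (dvd_geom_sum_sub_card h p) (dvd_refl (p : ℤ))

open Finset in
theorem dvd_geom_sum_of_dvd_sub_one {a : ℤ} {n : ℕ} (hn : n ≠ 0)
    (h : ∀ q : ℕ, q.Prime → q ∣ n → (q : ℤ) ∣ a - 1) : (n : ℤ) ∣ ∑ i ∈ range n, a ^ i := by
  induction n using induction_on_primes with
  | zero => exact absurd rfl hn
  | one => simp
  | prime_mul p k hp ih =>
    rw [mul_comm p k, geom_sum_range_mul]
    push_cast
    exact mul_dvd_mul
      (ih (right_ne_zero_of_mul hn) fun q hq hqk => h q hq (hqk.mul_left p))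
      (prime_dvd_geom_sum ((h p hp (dvd_mul_right p k)).trans (sub_one_dvd_pow_sub_one a k)))

open Finset in
theorem dvd_pow_sub_one_of_dvd_sub_one {a d : ℤ} {n : ℕ} (hn : n ≠ 0) (hd : d ∣ a - 1)
    (h : ∀ q : ℕ, q.Prime → q ∣ n → (q : ℤ) ∣ a - 1) : d * n ∣ a ^ n - 1 := by
  rw [← mul_geom_sum]
  exact mul_dvd_mul hd (dvd_geom_sum_of_dvd_sub_one hn h)

open Finset in
theorem sq_dvd_geom_sum_prime {a : ℤ} {p : ℕ} (hp : p.Prime) (h : (p : ℤ) ∣ a - 1) :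
    (p * p : ℤ) ∣ ∑ i ∈ range p, a ^ i - p ∨ (p * p : ℤ) ∣ ∑ i ∈ range p, a ^ i := by
  obtain ⟨b, hb⟩ := h
  rcases hp.eq_two_or_odd' with rfl | hodd
  · simp only [sum_range_succ, range_zero, sum_empty, pow_zero, pow_one]
    push_cast at *
    omega
  · left
    have := odd_sq_dvd_geom_sum₂_sub (R := ℤ) (a := 1) (b := b) hodd
    simp only [one_pow, mul_one] at this
    rw [show a = 1 + p * b by linarith, ← sq]
    exact this

open Finset in
/-- If every prime factor of `p * k` divides `a - 1`, then modulo `p * k` the geometric sum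
`1 + a + ⋯ + a ^ (k - 1)` is either `k` or `0`. -/
theorem dvd_geom_sum_sub_or_dvd_geom_sum {a : ℤ} {p k : ℕ} (hp : p.Prime) (hpa : (p : ℤ) ∣ a - 1)
    (hk : k ≠ 0) (h : ∀ q : ℕ, q.Prime → q ∣ k → (q : ℤ) ∣ a - 1) :
    (p * k : ℤ) ∣ ∑ i ∈ range k, a ^ i - k ∨ (p * k : ℤ) ∣ ∑ i ∈ range k, a ^ i := by
  induction k using induction_on_primes with
  | zero => exact absurd rfl hk
  | one => simp
  | prime_mul q k hq ih =>
    have hka := sub_one_dvd_pow_sub_one a k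
    have hqa : (q : ℤ) ∣ a ^ k - 1 := (h q hq (dvd_mul_right q k)).trans hka
    have hstep : (p * q : ℤ) ∣ ∑ i ∈ range q, (a ^ k) ^ i - q ∨
        (p * q : ℤ) ∣ ∑ i ∈ range q, (a ^ k) ^ i := by
      by_cases hpq : p = q
      · subst hpq
        exact sq_dvd_geom_sum_prime hp hqa
      · left
        refine IsCoprime.mul_dvd (Nat.isCoprime_iff_coprime.2 ((Nat.coprime_primes hp hq).2 hpq))
          (dvd_geom_sum_sub_card (hpa.trans hka) q) ?_
        exact dvd_sub (prime_dvd_geom_sum hqa) dvd_rfl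
    rw [mul_comm q k, geom_sum_range_mul]
    push_cast
    rcases ih (right_ne_zero_of_mul hk) fun r hr hrk => h r hr (hrk.mul_left q) with
      ⟨x, hx⟩ | ⟨x, hx⟩
    · rw [sub_eq_iff_eq_add] at hx
      rcases hstep with ⟨y, hy⟩ | ⟨y, hy⟩
      · rw [sub_eq_iff_eq_add] at hy
        left
        exact ⟨p * x * y + x + y, by rw [hx, hy]; ring⟩
      · right
        exact ⟨(p * x + 1) * y, by rw [hx, hy]; ring⟩
    · right
      obtain ⟨y, hy⟩ := prime_dvd_geom_sum hqa
      exact ⟨x * y, by rw [hx, hy]; ring⟩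

theorem Int.prime_pow_dvd_pow_totient_sub_one {a : ℤ} {q j : ℕ} (hq : q.Prime)
    (h : ¬ (q : ℤ) ∣ a) : ((q ^ (j + 1) : ℕ) : ℤ) ∣ a ^ (q ^ j * (q - 1)) - 1 := by
  have hc : IsCoprime a ((q ^ (j + 1) : ℕ) : ℤ) := by
    push_cast
    exact ((Nat.prime_iff_prime_int.1 hq).coprime_iff_not_dvd.2 h).symm.pow_right
  have h1 := ZMod.pow_totient (n := q ^ (j + 1)) (ZMod.unitOfIsCoprime a hc)
  rw [Nat.totient_prime_pow_succ hq] at h1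
  rw [← ZMod.intCast_zmod_eq_zero_iff_dvd, ← Int.cast_zero, ← sub_eq_zero]
  have h2 := congrArg (Units.val) h1
  simp only [Units.val_pow_eq_pow_val, ZMod.coe_unitOfIsCoprime, Units.val_one] at h2
  push_cast
  rw [h2]
  simp

theorem exists_pow_sub_one_dvd {a : ℤ} {n p : ℕ} (hn : n ≠ 0) (hp : p.Prime) (hpn : p ∣ n)
    (hcop : IsCoprime a n)
    (hmax : ∀ q : ℕ, q.Prime → q ∣ n → ¬ (q : ℤ) ∣ a - 1 → q ≤ p) (hpa : ¬ (p : ℤ) ∣ a - 1) :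
    ∃ K : ℕ, (n : ℤ) ∣ a ^ K - 1 ∧ ¬ p ^ n.factorization p ∣ K := by
  classical
  obtain ⟨m, rfl⟩ := hpn
  set bad := (p * m).primeFactors.filter fun q : ℕ => ¬ (q : ℤ) ∣ a - 1 with hbad
  refine ⟨m * ∏ q ∈ bad, (q - 1), ?_, fun hK => ?_⟩
  · rw [Int.natCast_dvd, Nat.dvd_iff_prime_pow_dvd_dvd]
    intro q j hq hqj
    rw [← Int.natCast_dvd]
    rcases j with _ | j
    · simp
    have hqn : q ∣ p * m := (dvd_pow_self q j.succ_ne_zero).trans hqj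
    by_cases hqa : (q : ℤ) ∣ a - 1
    · have hqp : q ≠ p := fun e => hpa (e ▸ hqa)
      have hd : q ^ (j + 1) ∣ m :=
        (((Nat.coprime_primes hq hp).2 hqp).pow_left (j + 1)).dvd_of_dvd_mul_left hqj
      obtain ⟨c, hc⟩ := hd.mul_right (∏ q ∈ bad, (q - 1))
      rw [hc]
      refine (dvd_mul_left _ _).trans ((dvd_pow_sub_one_of_dvd_sub_one
        (pow_ne_zero _ hq.ne_zero) hqa fun r hr hrq => ?_).trans
        (pow_one_sub_dvd_pow_mul_sub_one a _ c))
      rwa [(Nat.prime_dvd_prime_iff_eq hr hq).1 (hr.dvd_of_dvd_pow hrq)]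
    · have hd : q ^ j ∣ m := by
        by_cases hqp : q = p
        · subst hqp
          exact Nat.dvd_of_mul_dvd_mul_left hq.pos (by rwa [← pow_succ'])
        · exact (pow_dvd_pow q j.le_succ).trans
            ((((Nat.coprime_primes hq hp).2 hqp).pow_left (j + 1)).dvd_of_dvd_mul_left hqj)
      have hd2 : q - 1 ∣ ∏ q ∈ bad, (q - 1) := Finset.dvd_prod_of_mem (fun q => q - 1) (by
        rw [hbad, Finset.mem_filter]
        exact ⟨Nat.mem_primeFactors.2 ⟨hq, hqn, hn⟩, hqa⟩)
      obtain ⟨c, hc⟩ := mul_dvd_mul hd hd2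
      rw [hc]
      refine (Int.prime_pow_dvd_pow_totient_sub_one hq fun hqa' => ?_).trans
        (pow_one_sub_dvd_pow_mul_sub_one a _ c)
      have h1 := hcop.isUnit_of_dvd' hqa' (Int.natCast_dvd_natCast.2 hqn)
      exact hq.one_lt.ne' (by simpa [Int.isUnit_iff_natAbs_eq] using h1)
  · have hc : Nat.Coprime (p ^ (p * m).factorization p) (∏ q ∈ bad, (q - 1)) := by
      refine Nat.Coprime.prod_right fun q hq => Nat.Coprime.pow_left _ ?_
      rw [hbad, Finset.mem_filter, Nat.mem_primeFactors] at hq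
      have := hmax q hq.1.1 hq.1.2.1 hq.2
      have := hq.1.1.two_le
      exact (Nat.coprime_of_lt_prime (n := q - 1) (by omega) (by omega) hp)
    have h1 := hc.dvd_of_dvd_mul_right hK
    refine Nat.pow_succ_factorization_not_dvd hn hp ?_
    rw [pow_succ']
    exact mul_dvd_mul_left p h1

/-- Elements `A, B, C` with `C = [A, B]` satisfying the Macdonald relations `A ^ C = A ^ a` and
`B ^ C⁻¹ = B ^ b`. -/
structure IsMacdonaldTriple {G : Type*} [Group G] (A B C : G) (a b : ℤ) : Prop where
  comm : A * B = B * A * C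
  left : A * C = C * A ^ a
  right : C * B = B ^ b * C

namespace IsMacdonaldTriple

variable {G : Type*} [Group G] {A B C : G} {a b : ℤ}

theorem symm (h : IsMacdonaldTriple A B C a b) : IsMacdonaldTriple B A C⁻¹ b a where
  comm := by rw [eq_mul_inv_iff_mul_eq, h.comm]
  left := by rw [eq_inv_mul_iff_mul_eq, ← mul_assoc, h.right, mul_inv_cancel_right]
  right := by rw [eq_mul_inv_iff_mul_eq, mul_assoc, h.left, inv_mul_cancel_left]

theorem map {H : Type*} [Group H] (h : IsMacdonaldTriple A B C a b) (f : G →* H) :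
    IsMacdonaldTriple (f A) (f B) (f C) a b where
  comm := by simp only [← map_mul, h.comm]
  left := by simp only [← map_mul, ← map_zpow, h.left]
  right := by simp only [← map_mul, ← map_zpow, h.right]

theorem zpow_mul_left (h : IsMacdonaldTriple A B C a b) (k : ℤ) : A ^ k * C = C * A ^ (k * a) := by
  have h1 : SemiconjBy C (A ^ a) A := h.left.symm
  rw [mul_comm, zpow_mul]
  exact (h1.zpow_right k).eq.symm

theorem zpow_mul_pow (h : IsMacdonaldTriple A B C a b) (k : ℤ) (n : ℕ) :
    A ^ k * C ^ n = C ^ n * A ^ (k * a ^ n) := by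
  induction n with
  | zero => simp
  | succ n ih => rw [pow_succ, ← mul_assoc, ih, mul_assoc, h.zpow_mul_left, pow_succ]; group

theorem mul_pow_right (h : IsMacdonaldTriple A B C a b) (n : ℕ) :
    A * C ^ n = C ^ n * A ^ a ^ n := by
  simpa using h.zpow_mul_pow 1 n

theorem pow_mul_zpow (h : IsMacdonaldTriple A B C a b) (k : ℤ) (n : ℕ) :
    C ^ n * B ^ k = B ^ (k * b ^ n) * C ^ n := by
  have h1 := h.symm.zpow_mul_pow k n
  rw [inv_pow, eq_inv_mul_iff_mul_eq, ← mul_assoc, mul_inv_eq_iff_eq_mul] at h1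
  exact h1

theorem mul_commutator_pow (h : IsMacdonaldTriple A B C a b) (n : ℕ) :
    (A * C) ^ n = C ^ n * A ^ (a * ∑ i ∈ Finset.range n, a ^ i) := by
  induction n with
  | zero => simp
  | succ n ih =>
    rw [pow_succ, ih, geom_sum_succ, h.left, mul_assoc, ← mul_assoc _ C, h.zpow_mul_left, pow_succ,
      mul_assoc C, ← zpow_add, ← mul_assoc]
    congr 2
    ring

theorem pow_mul (h : IsMacdonaldTriple A B C a b) (n : ℕ) :
    A ^ n * B = B * (C ^ n * A ^ (a * ∑ i ∈ Finset.range n, a ^ i)) := by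
  have h1 : SemiconjBy B (A * C) A := by rw [SemiconjBy, h.comm, mul_assoc]
  rw [← h.mul_commutator_pow]
  exact (h1.pow_right n).eq.symm

theorem pow_eq_of_pow_eq_one (h : IsMacdonaldTriple A B C a b) {n : ℕ} (hn : A ^ n = 1) :
    C ^ n * A ^ (a * ∑ i ∈ Finset.range n, a ^ i) = 1 := by
  have h1 := h.pow_mul n
  rw [hn, one_mul] at h1
  exact (mul_eq_left.1 h1.symm)

theorem isOfFinOrder_commutator (h : IsMacdonaldTriple A B C a b) (hA : IsOfFinOrder A) :
    IsOfFinOrder C := by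
  obtain ⟨n, hn, hAn⟩ := isOfFinOrder_iff_pow_eq_one.1 hA
  have h1 := eq_inv_of_mul_eq_one_left (h.pow_eq_of_pow_eq_one hAn)
  have h2 : IsOfFinOrder (C ^ n) := by
    rw [h1]
    exact (hA.zpow).inv
  exact (isOfFinOrder_pow.1 h2).resolve_right hn.ne'

/-- The relation obtained by computing the conjugates of `A` and `B` by `C ^ 2 * B` and
`C ^ 2 * A` in two ways. -/
theorem zpow_mul_pow_eq_pow_mul_zpow (h : IsMacdonaldTriple A B C a b) {M N : ℕ}
    (hM : (M : ℤ) = a ^ 2) (hN : (N : ℤ) = b ^ 2) :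
    B ^ (b ^ (N + 2) - b * ∑ i ∈ Finset.range N, b ^ i) * C ^ (N + 2) =
      C ^ (M + 2) * A ^ (a * ∑ i ∈ Finset.range M, a ^ i - M * a ^ M) := by
  set s := a * ∑ i ∈ Finset.range M, a ^ i with hs
  set t := b * ∑ i ∈ Finset.range N, b ^ i with ht
  have hAC : A * C ^ 2 = C ^ 2 * A ^ M := by rw [h.mul_pow_right, ← hM, zpow_natCast]
  have hCB : C ^ 2 * B = B ^ N * C ^ 2 := by
    have := h.pow_mul_zpow 1 2
    rwa [zpow_one, one_mul, ← hN, zpow_natCast] at this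
  have h1 : A * (C ^ 2 * B) = C ^ 2 * B * (C ^ M * A ^ s) := by
    rw [← mul_assoc, hAC, mul_assoc, h.pow_mul, mul_assoc]
  have h2 : C ^ 2 * B * A ^ M = A * ((C ^ N)⁻¹ * B ^ t) * C ^ 2 := by
    have h3 := h.symm.pow_mul N
    rw [inv_pow, ← ht] at h3
    rw [← h3, hCB, mul_assoc, mul_assoc, hAC]
  have h4 : C ^ N * (C ^ 2 * B) = B ^ t * (C ^ (M + 2) * A ^ (s - M * a ^ M)) := by
    have h5 : C ^ 2 * B = (C ^ N)⁻¹ * B ^ t * C ^ 2 * (A ^ M)⁻¹ * (C ^ M * A ^ s) := by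
      rw [← mul_right_inj A, h1, eq_mul_inv_of_mul_eq h2]
      simp only [mul_assoc]
    rw [h5]
    have h6 := h.zpow_mul_pow (-M) M
    rw [zpow_neg, zpow_natCast] at h6
    rw [mul_assoc, ← mul_assoc _ (C ^ M), h6, sub_eq_neg_add, zpow_add, add_comm M 2, pow_add]
    group
  have h7 := h.pow_mul_zpow 1 (N + 2)
  rw [zpow_one, one_mul] at h7
  rw [sub_eq_neg_add, zpow_add, mul_assoc, ← h7, zpow_neg, inv_mul_eq_iff_eq_mul, ← h4, pow_add]
  group

end IsMacdonaldTriple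

namespace IsMacdonaldTriple

variable {G : Type*} [Group G] {A B C : G} {a b : ℤ}

theorem mul_pow_add (h : IsMacdonaldTriple A B C a b) {x : G} {m : ℕ} {k : ℤ}
    (hx : x * C ^ m = C ^ m * A ^ k) (j : ℕ) :
    x * C ^ (m + j) = C ^ (m + j) * A ^ (k * a ^ j) := by
  rw [pow_add, ← mul_assoc, hx, mul_assoc, h.zpow_mul_pow, mul_assoc]

/-- The union of the increasing chain of subgroups `C ^ m * ⟨A⟩ * C ^ (-m)`. -/
def conjUnion (h : IsMacdonaldTriple A B C a b) : Subgroup G where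
  carrier := {x | ∃ (m : ℕ) (k : ℤ), x * C ^ m = C ^ m * A ^ k}
  one_mem' := ⟨0, 0, by simp⟩
  mul_mem' := by
    rintro x y ⟨m, k, hx⟩ ⟨n, l, hy⟩
    refine ⟨m + n, k * a ^ n + l * a ^ m, ?_⟩
    rw [mul_assoc, add_comm m n, h.mul_pow_add hy, add_comm n m, ← mul_assoc, h.mul_pow_add hx,
      mul_assoc, zpow_add]
  inv_mem' := by
    rintro x ⟨m, k, hx⟩
    refine ⟨m, -k, ?_⟩
    rw [zpow_neg, inv_mul_eq_iff_eq_mul, ← mul_assoc, hx, mul_inv_cancel_right]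

theorem self_mem_conjUnion (h : IsMacdonaldTriple A B C a b) : A ∈ h.conjUnion :=
  ⟨0, 1, by simp⟩

theorem commute_of_mem_conjUnion (h : IsMacdonaldTriple A B C a b) {x : G}
    (hx : x ∈ h.conjUnion) : x * A = A * x := by
  obtain ⟨m, k, hx⟩ := hx
  rw [← mul_left_inj (C ^ m), mul_assoc, mul_assoc, hx, h.mul_pow_right, ← mul_assoc, hx,
    ← mul_assoc, h.mul_pow_right, mul_assoc, mul_assoc, ← zpow_add, ← zpow_add, add_comm]

theorem conj_mem_conjUnion (h : IsMacdonaldTriple A B C a b) {x : G}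
    (hx : x ∈ h.conjUnion) (e : ℤ) : C ^ e * x * C ^ (-e) ∈ h.conjUnion := by
  obtain ⟨m, k, hx⟩ := hx
  obtain ⟨n, rfl | rfl⟩ := e.eq_nat_or_neg
  · refine ⟨m + n, k, ?_⟩
    rw [zpow_neg, zpow_natCast, add_comm, pow_add, ← mul_assoc, inv_mul_cancel_right, mul_assoc, hx,
      mul_assoc]
  · refine ⟨m, k * a ^ n, ?_⟩
    have h1 := h.mul_pow_add hx n
    rw [neg_neg, zpow_neg, zpow_natCast, mul_assoc, ← pow_add, mul_assoc, add_comm, add_comm m,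
      inv_mul_eq_iff_eq_mul, ← mul_assoc, ← pow_add, add_comm]
    exact h1

theorem zpow_neg_mul_zpow_mem_conjUnion (h : IsMacdonaldTriple A B C a b) (e r j : ℤ) :
    C ^ (-(e * j)) * (C ^ e * A ^ r) ^ j ∈ h.conjUnion := by
  have hA : A ^ r ∈ h.conjUnion := zpow_mem h.self_mem_conjUnion r
  induction j using Int.induction_on with
  | zero => simp
  | succ i ih =>
    have h1 := mul_mem (h.conj_mem_conjUnion ih (-e)) hA
    convert h1 using 1
    rw [zpow_add_one]
    group
  | pred i ih =>
    have h1 := h.conj_mem_conjUnion (mul_mem ih (inv_mem hA)) e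
    convert h1 using 1
    rw [zpow_sub_one]
    group

theorem zpow_sq_sub_sq (h : IsMacdonaldTriple A B C a b) {M : ℕ} (hM : (M : ℤ) = a ^ 2) :
    (C ^ (a ^ 2 - b ^ 2) * A ^ (a * (a * ∑ i ∈ Finset.range M, a ^ i - M * a ^ M))) ^ b =
      C ^ (a ^ 2 - b ^ 2) * A ^ (a * ∑ i ∈ Finset.range M, a ^ i - M * a ^ M) := by
  have hN : ((b.natAbs ^ 2 : ℕ) : ℤ) = b ^ 2 := by simp
  have key := h.zpow_mul_pow_eq_pow_mul_zpow hM hN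
  set P := a * ∑ i ∈ Finset.range M, a ^ i - M * a ^ M
  set N := b.natAbs ^ 2
  set Q := b ^ (N + 2) - b * ∑ i ∈ Finset.range N, b ^ i
  have hW : C ^ (a ^ 2 - b ^ 2) * A ^ P = (C ^ (N + 2))⁻¹ * B ^ Q * C ^ (N + 2) := by
    rw [mul_assoc, key, ← hM, ← hN, ← mul_assoc, ← zpow_natCast, ← zpow_natCast, ← zpow_neg,
      ← zpow_add]
    congr 2
    push_cast
    ring
  have hV : C ^ (a ^ 2 - b ^ 2) * A ^ (a * P) = C⁻¹ * (C ^ (a ^ 2 - b ^ 2) * A ^ P) * C := by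
    rw [mul_assoc, mul_assoc, h.zpow_mul_left, mul_comm a P]
    group
  have hQ : C⁻¹ * B ^ (Q * b) * C = B ^ Q := by
    rw [mul_assoc, inv_mul_eq_iff_eq_mul]
    simpa using (h.pow_mul_zpow Q 1).symm
  have hconj : ∀ x y : G, (x⁻¹ * y * x) ^ b = x⁻¹ * y ^ b * x := fun x y => by
    simpa using conj_zpow (a := x⁻¹) (b := y) (i := b)
  rw [hV, hconj, hW, hconj, ← zpow_mul]
  rw [← hQ]
  group

theorem isOfFinOrder_of_two_le_natAbs (h : IsMacdonaldTriple A B C a b) (ha : 2 ≤ a.natAbs)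
    (hb : b ≠ 1) : IsOfFinOrder A := by
  rw [isOfFinOrder_iff_zpow_eq_one]
  have hM : ((a.natAbs ^ 2 : ℕ) : ℤ) = a ^ 2 := by simp
  have key := h.zpow_sq_sub_sq hM
  set M := a.natAbs ^ 2
  by_cases he : a ^ 2 - b ^ 2 = 0
  · rw [he, zpow_zero, one_mul, one_mul, ← zpow_mul] at key
    refine ⟨(a * b - 1) * (a * ∑ i ∈ Finset.range M, a ^ i - M * a ^ M), mul_ne_zero ?_ ?_, ?_⟩
    · intro h0
      have h1 := Int.isUnit_iff_natAbs_eq.1 (IsUnit.of_mul_eq_one b (sub_eq_zero.1 h0))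
      omega
    · intro h0
      have hM4 : 4 ≤ M := Nat.pow_le_pow_left ha 2
      obtain ⟨m, hm⟩ : ∃ m, M = m + 2 := ⟨M - 2, by omega⟩
      rw [hm, sub_eq_zero, pow_succ', mul_left_comm] at h0
      have h1 := mul_left_cancel₀ (by omega : a ≠ 0) h0
      rw [geom_sum_succ, pow_succ, ← mul_assoc] at h1
      have h2 : a ∣ 1 := (Int.dvd_add_right (dvd_mul_right a _)).1 (h1 ▸ dvd_mul_left a _)
      have := Int.isUnit_iff_natAbs_eq.1 (isUnit_of_dvd_one h2)
      omega
    · rw [sub_mul, zpow_sub, mul_inv_eq_one, one_mul, ← key]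
      congr 1
      ring
  · have hmem := h.zpow_neg_mul_zpow_mem_conjUnion (a ^ 2 - b ^ 2)
      (a * (a * ∑ i ∈ Finset.range M, a ^ i - M * a ^ M)) b
    rw [key, ← mul_assoc, ← zpow_add, mul_mem_cancel_right (zpow_mem h.self_mem_conjUnion _)]
      at hmem
    set e := -((a ^ 2 - b ^ 2) * b) + (a ^ 2 - b ^ 2) with hedef
    have he0 : e ≠ 0 := by
      rw [hedef, show -((a ^ 2 - b ^ 2) * b) + (a ^ 2 - b ^ 2) = (a ^ 2 - b ^ 2) * (1 - b) by ring]
      exact mul_ne_zero he (sub_ne_zero.2 hb.symm)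
    have hcomm : A * C ^ e.natAbs = C ^ e.natAbs * A := by
      have h1 : Commute (C ^ e) A := h.commute_of_mem_conjUnion hmem
      rw [← zpow_natCast]
      rcases Int.natAbs_eq e with h2 | h2
      · rw [← h2]
        exact h1.symm
      · rw [← neg_eq_iff_eq_neg.2 h2, zpow_neg]
        exact h1.inv_left.symm
    rw [h.mul_pow_right, mul_right_inj] at hcomm
    refine ⟨a ^ e.natAbs - 1, fun h0 => ?_, by rw [zpow_sub, hcomm, zpow_one, mul_inv_cancel]⟩
    have h1 : a.natAbs ^ e.natAbs = 1 := by
      rw [← Int.natAbs_pow, sub_eq_zero.1 h0]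
      rfl
    have := (Nat.pow_eq_one.1 h1)
    omega

theorem isOfFinOrder_left_of_neg_one (h : IsMacdonaldTriple A B C (-1) b) (hB : IsOfFinOrder B) :
    IsOfFinOrder A := by
  obtain ⟨n, hn, hCn⟩ := isOfFinOrder_iff_pow_eq_one.1 (h.symm.isOfFinOrder_commutator hB).of_inv
  have h1 := h.pow_mul (2 * n)
  rw [geom_sum_range_mul, _root_.pow_mul' C, hCn] at h1
  simp [Finset.sum_range_succ] at h1
  exact isOfFinOrder_iff_pow_eq_one.2 ⟨2 * n, by omega, h1⟩

/-- If `a, b ≠ 1` then the element `A` of a Macdonald triple has finite order. -/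
theorem isOfFinOrder_left (h : IsMacdonaldTriple A B C a b) (ha : a ≠ 1) (hb : b ≠ 1) :
    IsOfFinOrder A := by
  by_cases ha2 : 2 ≤ a.natAbs
  · exact h.isOfFinOrder_of_two_le_natAbs ha2 hb
  obtain rfl | rfl : a = 0 ∨ a = -1 := by omega
  · have h1 := h.left
    rw [zpow_zero, mul_one, mul_eq_right] at h1
    rw [h1]
    exact IsOfFinOrder.one
  by_cases hb2 : 2 ≤ b.natAbs
  · exact h.isOfFinOrder_left_of_neg_one (h.symm.isOfFinOrder_of_two_le_natAbs hb2 ha)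
  obtain rfl | rfl : b = 0 ∨ b = -1 := by omega
  · have h1 := h.right
    rw [zpow_zero, one_mul, mul_eq_left] at h1
    exact h.isOfFinOrder_left_of_neg_one (h1 ▸ IsOfFinOrder.one)
  · have h1 := h.pow_mul 2
    simp [Finset.sum_range_succ] at h1
    have h2 := h.pow_mul_zpow 1 2
    simp at h2
    rw [← h2, mul_left_inj] at h1
    have h3 := h.zpow_mul_left 2
    rw [zpow_ofNat, h1, ← pow_succ, pow_succ', mul_right_inj, ← h1] at h3
    refine isOfFinOrder_iff_pow_eq_one.2 ⟨4, by norm_num, ?_⟩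
    rw [show 4 = 2 + 2 from rfl, pow_add]
    nth_rw 1 [h3]
    group

end IsMacdonaldTriple

namespace IsMacdonaldTriple

variable {G : Type*} [Group G] {A B C : G} {a b : ℤ}

theorem isCoprime_orderOf (h : IsMacdonaldTriple A B C a b) (hA : IsOfFinOrder A) :
    IsCoprime a (orderOf A) := by
  obtain ⟨n, hn, hCn⟩ := isOfFinOrder_iff_pow_eq_one.1 (h.isOfFinOrder_commutator hA)
  have h1 := h.mul_pow_right n
  rw [hCn, mul_one, one_mul] at h1
  obtain ⟨c, hc⟩ : (orderOf A : ℤ) ∣ a ^ n - 1 := by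
    rw [orderOf_dvd_iff_zpow_eq_one, zpow_sub, ← h1, zpow_one, mul_inv_cancel]
  refine ⟨a ^ (n - 1), -c, ?_⟩
  rw [pow_sub_one_mul hn.ne']
  linarith

theorem pow_commute_of_dvd (h : IsMacdonaldTriple A B C a b) {k : ℕ}
    (hk : (orderOf A : ℤ) ∣ a ^ k - 1) : Commute A (C ^ k) := by
  rw [orderOf_dvd_iff_zpow_eq_one, zpow_sub, zpow_one, mul_inv_eq_one] at hk
  rw [commute_iff_eq, h.mul_pow_right, hk]

/-- If `A ^ k` is conjugated by `B` to `C ^ k`, which commutes with `A`, and the order of `A ^ k`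
is coprime to `a - 1`, then `A ^ k` is fixed by `C`. -/
theorem pow_mul_sub_one_eq_one (h : IsMacdonaldTriple A B C a b) {k : ℕ} {m : ℤ}
    (hkB : A ^ k * B = B * C ^ k) (hm : (A ^ k) ^ m = 1) (hcop : IsCoprime (a - 1) m) :
    A ^ ((k : ℤ) * (a - 1)) = 1 := by
  set D := C ^ k with hD
  have hDC : Commute D C := (Commute.refl C).pow_left k
  have hconj : D = B⁻¹ * A ^ k * B := by rw [mul_assoc, hkB, inv_mul_cancel_left]
  have hDz : ∀ j : ℤ, D ^ j = B⁻¹ * (A ^ k) ^ j * B := fun j => by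
    rw [hconj]
    simpa using conj_zpow (a := B⁻¹) (b := A ^ k) (i := j)
  have hAC : A ^ k * C = C * (A ^ k) ^ a := by
    have := h.zpow_mul_left k
    rwa [zpow_mul, zpow_natCast] at this
  have h1 : D * B ^ (b - 1) = B ^ (b - 1) * D ^ a := by
    have h2 : B⁻¹ * C * B = B ^ (b - 1) * C := by
      rw [mul_assoc, h.right]
      group
    have h3 : D * (B⁻¹ * C * B) = B⁻¹ * C * B * D ^ a := by
      rw [hDz, hconj]
      have : B⁻¹ * (A ^ k * C) * B = B⁻¹ * (C * (A ^ k) ^ a) * B := by rw [hAC]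
      simpa [mul_assoc] using this
    rw [h2, ← mul_assoc, mul_assoc _ C, ← (hDC.zpow_left a).eq, ← mul_assoc, mul_left_inj] at h3
    exact h3
  have h4 : D ^ (a - 1) = B ^ (-(b - 1) + (b - 1) * b ^ k) := by
    have h5 := h.pow_mul_zpow (b - 1) k
    rw [← hD, h1] at h5
    rw [zpow_add, zpow_neg, eq_inv_mul_iff_mul_eq, zpow_sub_one D, ← mul_assoc, h5,
      mul_inv_cancel_right]
  have h6 : Commute D B := by
    obtain ⟨x, y, hxy⟩ := hcop
    have hDm : D ^ m = 1 := by rw [hDz, hm]; group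
    have h7 : D = (D ^ (a - 1)) ^ x * (D ^ m) ^ y := by
      rw [← zpow_mul, ← zpow_mul, ← zpow_add, mul_comm (a - 1), mul_comm m, hxy, zpow_one]
    rw [h7, hDm, one_zpow, mul_one, h4]
    exact ((Commute.refl B).zpow_left _).zpow_left _
  rw [← h6.eq, mul_left_inj] at hkB
  rw [hkB, hDC.eq, mul_right_inj, ← hkB] at hAC
  rw [zpow_mul, zpow_sub, zpow_natCast, zpow_one, ← hAC, mul_inv_cancel]

/-- Every prime factor of the order of `A` divides `a - 1`. -/
theorem prime_dvd_sub_one (h : IsMacdonaldTriple A B C a b) (hA : IsOfFinOrder A) {q : ℕ}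
    (hq : q.Prime) (hqA : q ∣ orderOf A) : (q : ℤ) ∣ a - 1 := by
  classical
  by_contra hqa
  have hn : orderOf A ≠ 0 := hA.orderOf_pos.ne'
  set bad := (orderOf A).primeFactors.filter fun q : ℕ => ¬ (q : ℤ) ∣ a - 1 with hbad
  have hmem : ∀ r : ℕ, r ∈ bad ↔ (r.Prime ∧ r ∣ orderOf A) ∧ ¬ (r : ℤ) ∣ a - 1 := fun r => by
    simp [hbad, hn]
  obtain ⟨p, hp, hmax⟩ := bad.exists_max_image id ⟨q, (hmem q).2 ⟨⟨hq, hqA⟩, hqa⟩⟩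
  obtain ⟨⟨hpp, hpA⟩, hpa⟩ := (hmem p).1 hp
  obtain ⟨K, hK, hKp⟩ := exists_pow_sub_one_dvd hn hpp hpA (h.isCoprime_orderOf hA)
    (fun r hr hrA hra => hmax r ((hmem r).2 ⟨⟨hr, hrA⟩, hra⟩)) hpa
  obtain ⟨w, hw⟩ := Nat.ordProj_dvd (orderOf A) p
  set r := (orderOf A).factorization p
  have hpw : ¬ p ∣ w := fun hpw => by
    refine Nat.pow_succ_factorization_not_dvd hn hpp ?_
    rw [pow_succ]
    exact (mul_dvd_mul_left _ hpw).trans hw.symm.dvd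
  have hcop : IsCoprime (a - 1) ((p ^ r : ℕ) : ℤ) := by
    push_cast
    exact ((Nat.prime_iff_prime_int.1 hpp).coprime_iff_not_dvd.2 hpa).symm.pow_right
  have hcomm := h.pow_commute_of_dvd hK
  have hconj : A ^ (K * w) * B = B * C ^ (K * w) := by
    set s := a * ∑ i ∈ Finset.range K, a ^ i with hs
    have h1 : SemiconjBy B (C ^ K * A ^ s) (A ^ K) := (h.pow_mul K).symm
    have h2 : A ^ (s * w) = 1 := by
      rw [← orderOf_dvd_iff_zpow_eq_one]
      nth_rw 1 [hw]
      push_cast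
      refine mul_dvd_mul_right (Dvd.dvd.mul_left ?_ a) _
      refine hcop.symm.dvd_of_dvd_mul_left ?_
      rw [mul_geom_sum]
      refine dvd_trans ?_ hK
      rw [hw]
      push_cast
      exact dvd_mul_right _ _
    have h3 := (h1.pow_right w).eq
    rw [(hcomm.symm.zpow_right s).mul_pow, ← zpow_natCast (A ^ s), ← zpow_mul, h2, mul_one,
      ← _root_.pow_mul, ← _root_.pow_mul] at h3
    exact h3.symm
  have h4 : (A ^ (K * w)) ^ ((p ^ r : ℕ) : ℤ) = 1 := by
    rw [zpow_natCast, ← _root_.pow_mul, mul_assoc, mul_comm w, ← hw, mul_comm, _root_.pow_mul,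
      pow_orderOf_eq_one, one_pow]
  have h5 := h.pow_mul_sub_one_eq_one hconj h4 hcop
  rw [← orderOf_dvd_iff_zpow_eq_one] at h5
  have h6 := hcop.symm.dvd_of_dvd_mul_right
    ((Int.natCast_dvd_natCast.2 (hw ▸ dvd_mul_right _ _)).trans h5)
  exact hKp (((hpp.coprime_iff_not_dvd.2 hpw).pow_left r).dvd_of_dvd_mul_right
    (Int.natCast_dvd_natCast.1 h6))

end IsMacdonaldTriple

universe u

theorem finite_and_isNilpotent_of_central {G : Type u} [Group G] {z : G}
    (hz : z ∈ Subgroup.center G) (hfin : IsOfFinOrder z)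
    (H : ∀ (Q : Type u) [Group Q] (f : G →* Q), Function.Surjective f → f z = 1 →
      Finite Q ∧ Group.IsNilpotent Q) : Finite G ∧ Group.IsNilpotent G := by
  have hle : Subgroup.zpowers z ≤ Subgroup.center G := by rwa [Subgroup.zpowers_le]
  have hnormal : (Subgroup.zpowers z).Normal :=
    ⟨fun x hx g => by rwa [Subgroup.mem_center_iff.1 (hle hx) g, mul_inv_cancel_right]⟩
  obtain ⟨h1, h2⟩ := H (G ⧸ Subgroup.zpowers z) (QuotientGroup.mk' _)
    (QuotientGroup.mk'_surjective _)
    ((QuotientGroup.eq_one_iff z).2 (Subgroup.mem_zpowers z))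
  have h3 : Finite (Subgroup.zpowers z) := hfin.finite_zpowers
  refine ⟨Finite.of_subgroup_quotient (Subgroup.zpowers z),
    Subgroup.isNilpotent_of_ker_le_center (QuotientGroup.mk' (Subgroup.zpowers z)) ?_⟩
  rwa [QuotientGroup.ker_mk']

namespace IsMacdonaldTriple

variable {G : Type u} [Group G] {A B C : G} {a b : ℤ}

theorem finite_and_isNilpotent_of_commute (h : IsMacdonaldTriple A B C a b)
    (hgen : Subgroup.closure {A, B} = ⊤) {z : G} (hzA : Commute z A) (hzB : Commute z B)
    (hfin : IsOfFinOrder z)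
    (H : ∀ (Q : Type u) [Group Q] (f : G →* Q), f z = 1 →
      IsMacdonaldTriple (f A) (f B) (f C) a b → Subgroup.closure {f A, f B} = ⊤ →
      Finite Q ∧ Group.IsNilpotent Q) : Finite G ∧ Group.IsNilpotent G := by
  refine finite_and_isNilpotent_of_central ?_ hfin fun Q _ f hf hfz => H Q f hfz (h.map f) ?_
  · have h1 : Subgroup.closure {A, B} ≤ Subgroup.centralizer {z} := by
      rw [Subgroup.closure_le]
      rintro x (rfl | rfl)
      · exact Subgroup.mem_centralizer_singleton_iff.2 hzA.eq.symm
      · exact Subgroup.mem_centralizer_singleton_iff.2 hzB.eq.symm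
    rw [hgen] at h1
    exact Subgroup.mem_center_iff.2 fun g =>
      Subgroup.mem_centralizer_singleton_iff.1 (h1 (Subgroup.mem_top g))
  · have h1 := congrArg (Subgroup.map f) hgen
    rwa [MonoidHom.map_closure, Set.image_pair, Subgroup.map_top_of_surjective f hf] at h1

theorem commutator_pow_eq_one (h : IsMacdonaldTriple A B C a b) {n : ℕ} (hn : n ≠ 0)
    (ha : ∀ q : ℕ, q.Prime → q ∣ n → (q : ℤ) ∣ a - 1) (hA : A ^ n = 1) : C ^ n = 1 := by
  have h1 := h.pow_eq_of_pow_eq_one hA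
  obtain ⟨c, hc⟩ := (dvd_geom_sum_of_dvd_sub_one hn ha).mul_left a
  rwa [hc, zpow_mul, zpow_natCast, hA, one_zpow, mul_one] at h1

theorem commutator_pow_commute (h : IsMacdonaldTriple A B C a b) {p k : ℕ} (hk : k ≠ 0)
    (hpa : (p : ℤ) ∣ a - 1) (ha : ∀ q : ℕ, q.Prime → q ∣ k → (q : ℤ) ∣ a - 1)
    (hA : A ^ (p * k) = 1) : Commute (C ^ k) A := by
  refine (h.pow_commute_of_dvd (dvd_trans ?_ (dvd_pow_sub_one_of_dvd_sub_one hk hpa ha))).symm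
  exact_mod_cast orderOf_dvd_of_pow_eq_one hA

theorem pow_commute (h : IsMacdonaldTriple A B C a b) {p k : ℕ} (hp : p.Prime) (hk : k ≠ 0)
    (hpa : (p : ℤ) ∣ a - 1) (ha : ∀ q : ℕ, q.Prime → q ∣ k → (q : ℤ) ∣ a - 1)
    (hA : A ^ (p * k) = 1) (hC : C ^ k = 1) : Commute (A ^ k) B := by
  have h1 := h.pow_mul k
  rw [hC, one_mul] at h1
  have hz : ∀ c : ℤ, A ^ ((p * k : ℤ) * c) = 1 := fun c => by
    rw [zpow_mul, ← Nat.cast_mul, zpow_natCast, hA, one_zpow]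
  rcases dvd_geom_sum_sub_or_dvd_geom_sum hp hpa hk ha with ⟨c, hc⟩ | ⟨c, hc⟩
  · obtain ⟨d, hd⟩ := hpa
    have h2 : a * ∑ i ∈ Finset.range k, a ^ i = p * k * (a * c + d) + k := by
      linear_combination a * hc + (k : ℤ) * hd
    rwa [h2, zpow_add, hz, one_mul, zpow_natCast] at h1
  · rw [hc, mul_left_comm, hz, mul_one, mul_eq_right] at h1
    rw [h1]
    exact Commute.one_left B

theorem finite_and_isNilpotent_of_pow_eq_one {n : ℕ} (hn : n ≠ 0)
    (ha : ∀ q : ℕ, q.Prime → q ∣ n → (q : ℤ) ∣ a - 1)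
    (hb : ∀ q : ℕ, q.Prime → q ∣ n → (q : ℤ) ∣ b - 1)
    {G : Type u} [Group G] {A B C : G} (h : IsMacdonaldTriple A B C a b)
    (hgen : Subgroup.closure {A, B} = ⊤) (hA : A ^ n = 1) (hB : B ^ n = 1) :
    Finite G ∧ Group.IsNilpotent G := by
  induction n using induction_on_primes generalizing G with
  | zero => exact absurd rfl hn
  | one =>
    rw [pow_one] at hA hB
    rw [hA, hB, Set.pair_eq_singleton, Subgroup.closure_singleton_one] at hgen
    have := subsingleton_of_bot_eq_top hgen
    have : Subsingleton G := Subgroup.subsingleton_iff.1 this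
    exact ⟨inferInstance, inferInstance⟩
  | prime_mul p k hp ih =>
    have hk := right_ne_zero_of_mul hn
    have hpa := ha p hp (dvd_mul_right p k)
    have hpb := hb p hp (dvd_mul_right p k)
    have ha' : ∀ q : ℕ, q.Prime → q ∣ k → (q : ℤ) ∣ a - 1 :=
      fun q hq hqk => ha q hq (hqk.mul_left p)
    have hb' : ∀ q : ℕ, q.Prime → q ∣ k → (q : ℤ) ∣ b - 1 :=
      fun q hq hqk => hb q hq (hqk.mul_left p)
    have hfin : ∀ {Q : Type u} [Group Q] {x : Q}, x ^ (p * k) = 1 → IsOfFinOrder (x ^ k) :=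
      fun hx => (isOfFinOrder_iff_pow_eq_one.2 ⟨p * k, Nat.pos_of_ne_zero hn, hx⟩).pow
    have hCB : Commute (C ^ k) B := by
      have := h.symm.commutator_pow_commute hk hpb hb' hB
      rwa [inv_pow, Commute.inv_left_iff] at this
    refine h.finite_and_isNilpotent_of_commute hgen (h.commutator_pow_commute hk hpa ha' hA) hCB
      (hfin (h.commutator_pow_eq_one hn ha hA)) fun Q _ f hfC h1 hgen1 => ?_
    rw [map_pow] at hfC
    have hA1 : f A ^ (p * k) = 1 := by rw [← map_pow, hA, map_one]
    have hB1 : f B ^ (p * k) = 1 := by rw [← map_pow, hB, map_one]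
    refine h1.finite_and_isNilpotent_of_commute hgen1 ((Commute.refl (f A)).pow_left k)
      (h1.pow_commute hp hk hpa ha' hA1 hfC) (hfin hA1) fun R _ g hgA h2 hgen2 => ?_
    rw [map_pow] at hgA
    have hB2 : g (f B) ^ (p * k) = 1 := by rw [← map_pow, hB1, map_one]
    have hC2 : (g (f C))⁻¹ ^ k = 1 := by rw [inv_pow, ← map_pow, hfC, map_one, inv_one]
    refine h2.finite_and_isNilpotent_of_commute hgen2
      (h2.symm.pow_commute hp hk hpb hb' hB2 hC2) ((Commute.refl (g (f B))).pow_left k)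
      (hfin hB2) fun S _ e heB h3 hgen3 => ?_
    rw [map_pow] at heB
    exact ih hk ha' hb' h3 hgen3 (by rw [← map_pow, hgA, map_one]) heB

theorem pow_commute_of_not_dvd (h : IsMacdonaldTriple A B C a b) {p k m : ℕ} (hp : p.Prime)
    (hk : k ≠ 0) (hm : m ≠ 0)
    (ha : ∀ q : ℕ, q.Prime → q ∣ p * k → (q : ℤ) ∣ a - 1)
    (hb : ∀ q : ℕ, q.Prime → q ∣ m → (q : ℤ) ∣ b - 1)
    (hA : A ^ (p * k) = 1) (hB : B ^ m = 1) (hpm : ¬ p ∣ m) : Commute (A ^ k) B := by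
  refine h.pow_commute hp hk (ha p hp (dvd_mul_right p k))
    (fun q hq hqk => ha q hq (hqk.mul_left p)) hA ?_
  have h1 := h.commutator_pow_eq_one (mul_ne_zero hp.ne_zero hk) ha hA
  have h2 := h.symm.commutator_pow_eq_one hm hb hB
  rw [inv_pow, inv_eq_one, ← orderOf_dvd_iff_pow_eq_one] at h2
  rw [← orderOf_dvd_iff_pow_eq_one] at h1 ⊢
  refine Nat.Coprime.dvd_of_dvd_mul_left ?_ h1
  exact (hp.coprime_iff_not_dvd.2 fun hp' => hpm (hp'.trans h2)).symm

theorem finite_and_isNilpotent_of_pow_eq_one_of_pow_eq_one {n m : ℕ} (hn : n ≠ 0) (hm : m ≠ 0)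
    (ha : ∀ q : ℕ, q.Prime → q ∣ n → (q : ℤ) ∣ a - 1)
    (hb : ∀ q : ℕ, q.Prime → q ∣ m → (q : ℤ) ∣ b - 1)
    {G : Type u} [Group G] {A B C : G} (h : IsMacdonaldTriple A B C a b)
    (hgen : Subgroup.closure {A, B} = ⊤) (hA : A ^ n = 1) (hB : B ^ m = 1) :
    Finite G ∧ Group.IsNilpotent G := by
  induction hs : n + m using Nat.strong_induction_on generalizing n m G with
  | _ s ih =>
  by_cases h1 : ∃ p : ℕ, p.Prime ∧ p ∣ n ∧ ¬ p ∣ m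
  · obtain ⟨p, hp, ⟨k, rfl⟩, hpm⟩ := h1
    have hk := right_ne_zero_of_mul hn
    refine h.finite_and_isNilpotent_of_commute hgen ((Commute.refl A).pow_left k)
      (h.pow_commute_of_not_dvd hp hk hm ha hb hA hB hpm)
      (isOfFinOrder_iff_pow_eq_one.2 ⟨p * k, Nat.pos_of_ne_zero hn, hA⟩).pow
      fun Q _ f hfA h2 hgen2 => ?_
    refine ih (k + m) ?_ hk hm (fun q hq hqk => ha q hq (hqk.mul_left p)) hb h2 hgen2
      (by rw [← map_pow, hfA]) (by rw [← map_pow, hB, map_one]) rfl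
    have := Nat.mul_le_mul_right k hp.two_le
    omega
  by_cases h2 : ∃ p : ℕ, p.Prime ∧ p ∣ m ∧ ¬ p ∣ n
  · obtain ⟨p, hp, ⟨k, rfl⟩, hpm⟩ := h2
    have hk := right_ne_zero_of_mul hm
    refine h.finite_and_isNilpotent_of_commute hgen
      (h.symm.pow_commute_of_not_dvd hp hk hn hb ha hB hA hpm) ((Commute.refl B).pow_left k)
      (isOfFinOrder_iff_pow_eq_one.2 ⟨p * k, Nat.pos_of_ne_zero hm, hB⟩).pow
      fun Q _ f hfB h2 hgen2 => ?_
    refine ih (n + k) ?_ hn hk ha (fun q hq hqk => hb q hq (hqk.mul_left p)) h2 hgen2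
      (by rw [← map_pow, hA, map_one]) (by rw [← map_pow, hfB]) rfl
    have := Nat.mul_le_mul_right k hp.two_le
    omega
  push Not at h1 h2
  refine finite_and_isNilpotent_of_pow_eq_one (mul_ne_zero hn hm) (fun q hq hqnm => ?_)
    (fun q hq hqnm => ?_) h hgen (by rw [_root_.pow_mul, hA, one_pow])
    (by rw [mul_comm, _root_.pow_mul, hB, one_pow])
  · exact ha q hq (((Nat.Prime.dvd_mul hq).1 hqnm).elim id (h2 q hq))
  · exact hb q hq (((Nat.Prime.dvd_mul hq).1 hqnm).elim (h1 q hq) id)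

/-- A group generated by a Macdonald triple with `a, b ≠ 1` is finite and nilpotent. -/
theorem finite_and_isNilpotent (h : IsMacdonaldTriple A B C a b) (ha : a ≠ 1) (hb : b ≠ 1)
    (hgen : Subgroup.closure {A, B} = ⊤) : Finite G ∧ Group.IsNilpotent G := by
  have hA := h.isOfFinOrder_left ha hb
  have hB := h.symm.isOfFinOrder_left hb ha
  exact finite_and_isNilpotent_of_pow_eq_one_of_pow_eq_one hA.orderOf_pos.ne' hB.orderOf_pos.ne'
    (fun q hq => h.prime_dvd_sub_one hA hq) (fun q hq => h.symm.prime_dvd_sub_one hB hq) h hgen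
    (pow_orderOf_eq_one A) (pow_orderOf_eq_one B)

end IsMacdonaldTriple

theorem MacdonaldGroup.isMacdonaldTriple (α β : ℤ) :
    IsMacdonaldTriple (PresentedGroup.of 0 : MacdonaldGroup α β) (PresentedGroup.of 1)
      (commut (PresentedGroup.of 0) (PresentedGroup.of 1)) α β := by
  have h0 : (PresentedGroup.mk (relators α β)) (conjBy (FreeGroup.of 0)
      (commut (FreeGroup.of 0) (FreeGroup.of 1)) * (FreeGroup.of 0 ^ α)⁻¹) = 1 :=
    PresentedGroup.one_of_mem (Or.inl rfl)
  have h1 : (PresentedGroup.mk (relators α β)) (conjBy (FreeGroup.of 1)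
      (commut (FreeGroup.of 1) (FreeGroup.of 0)) * (FreeGroup.of 1 ^ β)⁻¹) = 1 :=
    PresentedGroup.one_of_mem (Or.inr rfl)
  rw [map_mul, map_inv, map_zpow, mul_inv_eq_one] at h0 h1
  simp only [conjBy, commut, map_mul, map_inv] at h0 h1
  refine ⟨by simp only [commut]; group, ?_, ?_⟩
  · change _ = _ * (PresentedGroup.mk (relators α β) (FreeGroup.of 0)) ^ α
    rw [← h0]
    simp only [commut, PresentedGroup.of]
    group
  · change _ = (PresentedGroup.mk (relators α β) (FreeGroup.of 1)) ^ β * _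
    rw [← h1]
    simp only [commut, PresentedGroup.of]
    group

theorem MacdonaldGroup.closure_generators (α β : ℤ) :
    Subgroup.closure {(PresentedGroup.of 0 : MacdonaldGroup α β), PresentedGroup.of 1} = ⊤ := by
  rw [← PresentedGroup.closure_range_of (relators α β)]
  congr 1
  ext x
  simp [Fin.exists_fin_two, eq_comm]

/-- A finite nilpotent group is the internal direct product of its Sylow subgroups. -/
theorem isInternalDirectProduct_sylow {G : Type*} [Group G] [Finite G] [Group.IsNilpotent G]
    (P : ∀ p : (Nat.card G).primeFactors, Sylow p G) :
    IsInternalDirectProduct fun p => (P p : Subgroup G) := by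
  have hfact : ∀ p : (Nat.card G).primeFactors, Fact (p : ℕ).Prime :=
    fun p => ⟨Nat.prime_of_mem_primeFactors p.2⟩
  have hnormal : ∀ p, (P p : Subgroup G).Normal := fun p => inferInstance
  refine ⟨hnormal, fun p => ?_, ?_⟩
  · have hcomm : Pairwise fun p q : (Nat.card G).primeFactors =>
        ∀ x y : G, x ∈ (P p : Subgroup G) → y ∈ (P q : Subgroup G) → Commute x y := by
      intro p q hne
      exact Subgroup.commute_of_normal_of_disjoint _ _ (hnormal p) (hnormal q)
        (IsPGroup.disjoint_of_ne p q (fun e => hne (Subtype.ext e)) _ _ (P p).isPGroup'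
          (P q).isPGroup')
    have hind : iSupIndep fun p => (P p : Subgroup G) := by
      classical
      have := Fintype.ofFinite G
      refine Subgroup.independent_of_coprime_order hcomm fun p q hne => ?_
      simp only [← Nat.card_eq_fintype_card]
      exact IsPGroup.coprime_card_of_ne p q (fun e => hne (Subtype.ext e)) _ _ (P p).isPGroup'
        (P q).isPGroup'
    exact (hind p).eq_bot
  · refine Subgroup.eq_top_of_card_eq _ (Nat.dvd_antisymm (Subgroup.card_subgroup_dvd_card _) ?_)
    rw [Nat.dvd_iff_prime_pow_dvd_dvd]
    intro p k hp hpk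
    rcases Nat.eq_zero_or_pos k with rfl | hk
    · simp
    have hmem : p ∈ (Nat.card G).primeFactors := Nat.mem_primeFactors.2
      ⟨hp, (dvd_pow_self p hk.ne').trans hpk, Nat.card_pos.ne'⟩
    have := Fact.mk hp
    have h1 : p ^ k ∣ Nat.card (P ⟨p, hmem⟩) := by
      rw [Sylow.card_eq_multiplicity]
      exact pow_dvd_pow p ((hp.pow_dvd_iff_le_factorization Nat.card_pos.ne').1 hpk)
    exact h1.trans (Subgroup.card_dvd_of_le (le_iSup (fun p => (P p : Subgroup G)) ⟨p, hmem⟩))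

theorem theorem3p1 (α β : ℤ) (hα : α ≠ 1) (hβ : β ≠ 1) :
    Group.IsNilpotent (MacdonaldGroup α β) ∧
    Finite (MacdonaldGroup α β) ∧
    ∀ P : (∀ p : (Nat.card (MacdonaldGroup α β)).primeFactors, Sylow p (MacdonaldGroup α β)),
      IsInternalDirectProduct (fun p => (P p : Subgroup (MacdonaldGroup α β))) := by
  obtain ⟨hfin, hnil⟩ := (MacdonaldGroup.isMacdonaldTriple α β).finite_and_isNilpotent hα hβ
    (MacdonaldGroup.closure_generators α β)
  exact ⟨hnil, hfin, isInternalDirectProduct_sylow⟩
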